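/- Let $\mathbb{H}$ be a separable real or complex Hilbert space, let $\mathcal{Q}$ be a complete metric space with a continuous semiflow $\vartheta^{t}$, $t \ge 0$, and let $\Xi$ be a uniformly continuous linear cocycle in $\mathbb{H}$ over $(\mathcal{Q},\vartheta)$: bounded linear operators $\Xi^{t}(q,\cdot)$ on $\mathbb{H}$, $t\ge 0$, $q\in\mathcal{Q}$, with $\Xi^{0}(q,v)=v$ and $\Xi^{t+s}(q,v)=\Xi^{t}(\vartheta^{s}(q),\Xi^{s}(q,v))$, such that $(t,q,v)\mapsto \Xi^{t}(q,v)$ is continuous, $q\mapsto\Xi^{t}(q,\cdot)$ is continuous in the operator norm for each $t$, and $\sup_{t\in[0,1],\,q\in\mathcal{Q}}\|\Xi^{t}(q,\cdot)\|<\infty$. For each $q\in\mathcal{Q}$ let $\langle\cdot,\cdot\rangle_{q}$ be an inner product on $\mathbb{H}$ (linear in the first argument) with norm $\mathfrak{n}_{q}$, and suppose that $\Xi$ admits infinitesimal growth exponents with respect to $\mathfrak{n}=\{\mathfrak{n}_q\}$ with domains $\mathcal{N}(q)$: each $\mathcal{N}(q)$ is a dense linear subspace of $\mathbb{H}$, $\Xi^{t}(q,\mathcal{N}(q))\subset\mathcal{N}(\vartheta^{t}(q))$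 for all $t \ge 0$, and for all $q\in\mathcal{Q}$, $\xi\in\mathcal{N}(q)$ the function $t\mapsto\mathfrak{n}_{\vartheta^{t}(q)}(\Xi^{t}(q,\xi))$ is absolutely continuous on $[0,T]$ for every $T>0$ and has a finite right derivative at $t=0$. Let $$B_{\mathfrak{n}}(q;\xi,\eta)=\frac12\lim_{t\to0+}\frac{\langle\Xi^{t}(q,\xi),\Xi^{t}(q,\eta)\rangle_{\vartheta^{t}(q)}-\langle\xi,\eta\rangle_{q}}{t},\qquad \xi,\eta\in\mathcal{N}(q),$$ be the curvature form, and let $A_{\mathfrak{n}}$ be a mean representation of it: for each $q$, $A_{\mathfrak{n}}(q)$ is a (possibly unbounded) linear operator in $\mathbb{H}$ whose domain contains $\mathcal{N}(q)$, and $B_{\mathfrak{n}}(q;\xi,\xi)=\operatorname{Re}\langle\xi,A_{\mathfrak{n}}(q)\xi\rangle_{q}$ for all $\xi\in\mathcal{N}(q)$. On the exterior power of order $m$ let $\mathfrak{n}_{q}^{\wedge m}$ be the norm of the inner product determined by $\langle\xi_{1}\wedge\dots\wedge\xi_{m},\eta_{1}\wedge\dots\wedge\eta_{m}\rangle_{q}=\frac1{m!}\det[\langle\xi_{i},\eta_{j}\rangle_{q}]_{i,j=1}^m$,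 and let $\Xi^{t}_{m}(q,\xi_{1}\wedge\dots\wedge\xi_{m})=\Xi^{t}(q,\xi_{1})\wedge\dots\wedge\Xi^{t}(q,\xi_{m})$. Let $m\ge1$, $q\in\mathcal{Q}$, $\xi_{1},\dots,\xi_{m}\in\mathcal{N}(q)$, let $\Pi(s)$ be the $\langle\cdot,\cdot\rangle_{\vartheta^{s}(q)}$-orthogonal projector onto $\operatorname{Span}\{\Xi^{s}(q,\xi_{1}),\dots,\Xi^{s}(q,\xi_{m})\}$, and put $$v(t)=\mathfrak{n}^{\wedge m}_{\vartheta^{t}(q)}\bigl(\Xi^{t}_{m}(q,\xi_{1}\wedge\dots\wedge\xi_{m})\bigr),\qquad \rho(s)=\operatorname{Re}\operatorname{Tr}\bigl(\Pi(s)\circ A_{\mathfrak{n}}(\vartheta^{s}(q))\circ\Pi(s)\bigr).$$ Then the Liouville trace formula holds in the following sense. 1. For every $t\ge0$ with $v(t)\neq0$, the function $\rho$ is integrable on $[0,t]$ and $$\mathfrak{n}^{\wedge m}_{\vartheta^{t}(q)}\bigl(\Xi^{t}_{m}(q,\xi_{1}\wedge\dots\wedge\xi_{m})\bigr)=\mathfrak{n}^{\wedge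 m}_{q}(\xi_{1}\wedge\dots\wedge\xi_{m})\,\exp\left(\int_{0}^{t}\rho(s)\,ds\right).$$ 2. If $\mathfrak{n}^{\wedge m}_{q}(\xi_{1}\wedge\dots\wedge\xi_{m})=0$, then $v(t)=0$ for all $t\ge0$. 3. If $\mathfrak{n}^{\wedge m}_{q}(\xi_{1}\wedge\dots\wedge\xi_{m})\neq0$ and $v(t)=0$ for some $t \geq 0$, then there is $t_{0}\in(0,t]$ such that, for all $s\ge0$, $v(s)=0$ if and only if $s\ge t_{0}$; moreover $\int_{0}^{r}\rho(s)\,ds\to-\infty$ as $r\to t_{0}-$ (so the formula holds at $t_0$ with the integral improper and $e^{-\infty}=0$). -/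

import Mathlib

open scoped NNReal Topology

noncomputable section

namespace LiouvilleTrace

/-! ### Exterior powers with the inner product induced by an inner product on `H` -/

section Exterior

variable {𝕜 : Type*} [RCLike 𝕜] {H : Type*} [AddCommGroup H] [Module 𝕜 H]

/-- The norm `√⟨x, x⟩` of an inner product `c`. -/
def coreNorm (c : InnerProductSpace.Core 𝕜 H) (x : H) : ℝ :=
  Real.sqrt (RCLike.re (c.inner x x))

/-- The functional `w ↦ c.inner v w`; Mathlib's inner products are linear in the second variable. -/
def innerDual (c : InnerProductSpace.Core 𝕜 H) (v : H) : Module.Dual 𝕜 H where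
  toFun w := c.inner v w
  map_add' x y := by
    rw [← c.conj_inner_symm, c.add_left, map_add, c.conj_inner_symm, c.conj_inner_symm]
  map_smul' r x := by
    rw [← c.conj_inner_symm, c.smul_left, map_mul, c.conj_inner_symm, RCLike.conj_conj]
    rfl

/-- The dual space with the conjugate scalar multiplication `r • φ = conj r * φ`. -/
def ConjDual (𝕜 : Type*) [RCLike 𝕜] (V : Type*) [AddCommGroup V] [Module 𝕜 V] : Type _ :=
  Module.Dual 𝕜 V

instance (V : Type*) [AddCommGroup V] [Module 𝕜 V] : AddCommGroup (ConjDual 𝕜 V) :=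
  inferInstanceAs (AddCommGroup (Module.Dual 𝕜 V))

instance (V : Type*) [AddCommGroup V] [Module 𝕜 V] : Module 𝕜 (ConjDual 𝕜 V) :=
  Module.compHom (Module.Dual 𝕜 V) (starRingEnd 𝕜)

/-- The alternating map sending `v` to the functional that takes
`w₁ ∧ ⋯ ∧ wₘ` to `det [c.inner (v j) (w i)]`. -/
def wedgeAlternating (c : InnerProductSpace.Core 𝕜 H) (m : ℕ) :
    H [⋀^Fin m]→ₗ[𝕜] ConjDual 𝕜 (⋀[𝕜]^m H) where
  toFun v := exteriorPower.alternatingMapToDual 𝕜 H m (fun i => innerDual c (v i))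
  map_update_add' := by
    intro _ v i x y
    have hadd : innerDual c (x + y) = innerDual c x + innerDual c y := by
      ext w; exact c.add_left x y w
    have key : ∀ z, (fun j => innerDual c (Function.update v i z j))
        = Function.update (fun j => innerDual c (v j)) i (innerDual c z) := by
      intro z; funext j
      by_cases h : j = i
      · subst h; simp
      · simp [h]
    simp only [key, hadd]
    exact (exteriorPower.alternatingMapToDual 𝕜 H m).map_update_add _ _ _ _
  map_update_smul' := by
    intro _ v i r x
    have hsmul : innerDual c (r • x) = (starRingEnd 𝕜 r) • innerDual c x := by
      ext w; exact c.smul_left x w r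
    have key : ∀ z, (fun j => innerDual c (Function.update v i z j))
        = Function.update (fun j => innerDual c (v j)) i (innerDual c z) := by
      intro z; funext j
      by_cases h : j = i
      · subst h; simp
      · simp [h]
    simp only [key, hsmul]
    exact (exteriorPower.alternatingMapToDual 𝕜 H m).map_update_smul _ _ _ _
  map_eq_zero_of_eq' := by
    intro v i j hv hij
    exact (exteriorPower.alternatingMapToDual 𝕜 H m).map_eq_zero_of_eq _
      (congrArg (innerDual c) hv) hij

/-- The inner product on the `m`-th exterior power induced by `c`, determined by
`⟨v₁ ∧ ⋯ ∧ vₘ, w₁ ∧ ⋯ ∧ wₘ⟩ = (1 / m!) det [⟨v_j, w_i⟩]` and sesquilinearity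
(conjugate-linear in the first variable). -/
def wedgeInner (c : InnerProductSpace.Core 𝕜 H) (m : ℕ) (x y : ⋀[𝕜]^m H) : 𝕜 :=
  ((m.factorial : 𝕜))⁻¹ *
    (show Module.Dual 𝕜 (⋀[𝕜]^m H) from
      exteriorPower.alternatingMapLinearEquiv (wedgeAlternating c m) x) y

theorem wedgeInner_ιMulti (c : InnerProductSpace.Core 𝕜 H) (m : ℕ) (v w : Fin m → H) :
    wedgeInner c m (exteriorPower.ιMulti 𝕜 m v) (exteriorPower.ιMulti 𝕜 m w) =
      ((m.factorial : 𝕜))⁻¹ * Matrix.det (Matrix.of fun i j => c.inner (v j) (w i)) := by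
  unfold wedgeInner
  rw [exteriorPower.alternatingMapLinearEquiv_apply_ιMulti]
  congr 1
  exact exteriorPower.alternatingMapToDual_apply_ιMulti _ _

/-- The norm on the `m`-th exterior power induced by `c`. -/
def wedgeNorm (c : InnerProductSpace.Core 𝕜 H) (m : ℕ) (x : ⋀[𝕜]^m H) : ℝ :=
  Real.sqrt (RCLike.re (wedgeInner c m x x))

/-! ### Orthogonal projectors and traces of compressions -/

/-- The projector of `H` onto the finite-dimensional subspace `L`, orthogonal for `c`. -/
def orthProj (c : InnerProductSpace.Core 𝕜 H) (L : Submodule 𝕜 H) [FiniteDimensional 𝕜 L] :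
    H →ₗ[𝕜] H :=
  letI : NormedAddCommGroup H := c.toNormedAddCommGroup
  letI : InnerProductSpace 𝕜 H := InnerProductSpace.ofCore c.toCore
  (L.starProjection : H →L[𝕜] H).toLinearMap

theorem orthProj_mem (c : InnerProductSpace.Core 𝕜 H) (L : Submodule 𝕜 H)
    [FiniteDimensional 𝕜 L] (x : H) : orthProj c L x ∈ L := by
  let _ : NormedAddCommGroup H := c.toNormedAddCommGroup
  let _ : InnerProductSpace 𝕜 H := InnerProductSpace.ofCore c.toCore
  exact L.starProjection_apply_mem x

theorem inner_sub_orthProj (c : InnerProductSpace.Core 𝕜 H) (L : Submodule 𝕜 H)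
    [FiniteDimensional 𝕜 L] (x y : H) (hy : y ∈ L) : c.inner (x - orthProj c L x) y = 0 := by
  let _ : NormedAddCommGroup H := c.toNormedAddCommGroup
  let _ : InnerProductSpace 𝕜 H := InnerProductSpace.ofCore c.toCore
  exact L.starProjection_inner_eq_zero x y hy

/-- The everywhere defined operator `Π ∘ A ∘ Π`, where `Π` is the `c`-orthogonal projector onto
a finite-dimensional subspace `L` of the domain of the unbounded operator `A`. -/
def compression (c : InnerProductSpace.Core 𝕜 H) (A : H →ₗ.[𝕜] H) (L : Submodule 𝕜 H)
    [FiniteDimensional 𝕜 L] (hL : L ≤ A.domain) : H →ₗ[𝕜] H :=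
  orthProj c L ∘ₗ A.toFun ∘ₗ
    (orthProj c L).codRestrict A.domain (fun x => hL (orthProj_mem c L x))

/-- The trace of a linear operator of finite rank: the trace of its restriction to its range. -/
def finiteRankTrace (T : H →ₗ[𝕜] H) : 𝕜 :=
  LinearMap.trace 𝕜 (LinearMap.range T)
    (T.restrict (p := LinearMap.range T) (q := LinearMap.range T)
      (fun x _ => LinearMap.mem_range_self T x))

end Exterior

/-! ### Cocycles, metrics, curvature forms -/

section Cocycle

variable {𝕜 : Type*} [RCLike 𝕜] {H : Type*} [NormedAddCommGroup H] [InnerProductSpace 𝕜 H]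
  {Q : Type*} [MetricSpace Q]

/-- A uniformly continuous linear cocycle in `H` over the semiflow `θ`. -/
structure Cocycle (𝕜 : Type*) [RCLike 𝕜] (H : Type*) [NormedAddCommGroup H]
    [InnerProductSpace 𝕜 H] {Q : Type*} [MetricSpace Q] (θ : Flow ℝ≥0 Q) where
  toFun : ℝ≥0 → Q → H →L[𝕜] H
  map_zero : ∀ q v, toFun 0 q v = v
  map_add : ∀ t s q v, toFun (t + s) q v = toFun t (θ s q) (toFun s q v)
  continuous_apply : Continuous fun p : ℝ≥0 × Q × H => toFun p.1 p.2.1 p.2.2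
  continuous_opNorm : ∀ t, Continuous (toFun t)
  bounded : ∃ C : ℝ, ∀ t ≤ 1, ∀ q, ‖toFun t q‖ ≤ C

variable {θ : Flow ℝ≥0 Q}

/-- The `m`-fold compound cocycle, acting on exterior powers by
`ξ₁ ∧ ⋯ ∧ ξₘ ↦ Ξᵗ(q, ξ₁) ∧ ⋯ ∧ Ξᵗ(q, ξₘ)`. -/
def Cocycle.compound (Ξ : Cocycle 𝕜 H θ) (m : ℕ) (t : ℝ≥0) (q : Q) :
    ⋀[𝕜]^m H →ₗ[𝕜] ⋀[𝕜]^m H :=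
  exteriorPower.map m (Ξ.toFun t q).toLinearMap

/-- The volume of `Ξᵗₘ(q, ξ₁ ∧ ⋯ ∧ ξₘ)` in the metric induced on the exterior power by the inner
product over `θᵗ(q)`. -/
def evolvedVolume (Ξ : Cocycle 𝕜 H θ) (n : Q → InnerProductSpace.Core 𝕜 H) {m : ℕ}
    (t : ℝ≥0) (q : Q) (ξ : Fin m → H) : ℝ :=
  wedgeNorm (n (θ t q)) m (Ξ.compound m t q (exteriorPower.ιMulti 𝕜 m ξ))

/-- The cocycle `Ξ` admits infinitesimal growth exponents with respect to the family of inner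
products `n`, with the family of domains `N`. -/
structure AdmitsGrowthExponents (Ξ : Cocycle 𝕜 H θ) (n : Q → InnerProductSpace.Core 𝕜 H)
    (N : Q → Submodule 𝕜 H) : Prop where
  dense : ∀ q, Dense (N q : Set H)
  invariant : ∀ t q, ∀ ξ ∈ N q, Ξ.toFun t q ξ ∈ N (θ t q)
  absolutelyContinuous : ∀ q, ∀ ξ ∈ N q, ∀ T : ℝ, 0 < T →
    AbsolutelyContinuousOnInterval
      (fun t : ℝ => coreNorm (n (θ t.toNNReal q)) (Ξ.toFun t.toNNReal q ξ)) 0 T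
  rightDeriv : ∀ q, ∀ ξ ∈ N q, ∃ D : ℝ, Filter.Tendsto
    (fun t : ℝ =>
      (coreNorm (n (θ t.toNNReal q)) (Ξ.toFun t.toNNReal q ξ) - coreNorm (n q) ξ) / t)
    (𝓝[>] 0) (𝓝 D)

/-- The curvature form
`B(q; ξ, η) = (1 / 2) lim_{t → 0+} (⟨Ξᵗ(q, ξ), Ξᵗ(q, η)⟩ - ⟨ξ, η⟩) / t`, where the first inner
product is the one over `θᵗ(q)` and the second the one over `q`. It is linear in `ξ`, so that
the arguments of Mathlib's `inner` are interchanged. -/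
def curvatureForm (Ξ : Cocycle 𝕜 H θ) (n : Q → InnerProductSpace.Core 𝕜 H)
    (q : Q) (ξ η : H) : 𝕜 :=
  (2 : 𝕜)⁻¹ * Filter.limUnder (𝓝[>] (0 : ℝ)) (fun t : ℝ =>
    ((n (θ t.toNNReal q)).inner (Ξ.toFun t.toNNReal q η) (Ξ.toFun t.toNNReal q ξ)
      - (n q).inner η ξ) / ((t : ℝ) : 𝕜))

/-- The family `A` of unbounded operators is a mean representation of the curvature form:
`N(q) ⊆ D(A(q))` and `B(q; ξ, ξ) = Re ⟨ξ, A(q) ξ⟩_q` for `ξ ∈ N(q)`. -/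
structure IsMeanRepresentation (Ξ : Cocycle 𝕜 H θ) (n : Q → InnerProductSpace.Core 𝕜 H)
    (N : Q → Submodule 𝕜 H) (A : Q → H →ₗ.[𝕜] H) : Prop where
  le_domain : ∀ q, N q ≤ (A q).domain
  form_eq : ∀ q, ∀ ξ (hξ : ξ ∈ N q),
    curvatureForm Ξ n q ξ ξ =
      ((RCLike.re ((n q).inner (A q ⟨ξ, le_domain q hξ⟩) ξ) : ℝ) : 𝕜)

/-- `Span {Ξˢ(q, ξ₁), …, Ξˢ(q, ξₘ)}`. -/
def evolvedSpan (Ξ : Cocycle 𝕜 H θ) {m : ℕ} (s : ℝ≥0) (q : Q) (ξ : Fin m → H) :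
    Submodule 𝕜 H :=
  Submodule.span 𝕜 (Set.range fun j => Ξ.toFun s q (ξ j))

instance (Ξ : Cocycle 𝕜 H θ) {m : ℕ} (s : ℝ≥0) (q : Q) (ξ : Fin m → H) :
    FiniteDimensional 𝕜 (evolvedSpan Ξ s q ξ) :=
  FiniteDimensional.span_of_finite 𝕜 (Set.finite_range _)

theorem evolvedSpan_le_domain {Ξ : Cocycle 𝕜 H θ} {n : Q → InnerProductSpace.Core 𝕜 H}
    {N : Q → Submodule 𝕜 H} {A : Q → H →ₗ.[𝕜] H} (hN : AdmitsGrowthExponents Ξ n N)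
    (hA : IsMeanRepresentation Ξ n N A) {m : ℕ} {q : Q} {ξ : Fin m → H}
    (hξ : ∀ j, ξ j ∈ N q) (s : ℝ≥0) :
    evolvedSpan Ξ s q ξ ≤ (A (θ s q)).domain := by
  refine Submodule.span_le.2 ?_
  rintro _ ⟨j, rfl⟩
  exact hA.le_domain _ (hN.invariant s q _ (hξ j))

/-- `Re Tr (Π(s) ∘ A(θˢ(q)) ∘ Π(s))`, where `Π(s)` is the projector onto
`Span {Ξˢ(q, ξ₁), …, Ξˢ(q, ξₘ)}` orthogonal with respect to the inner product over `θˢ(q)`. -/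
def traceRate {Ξ : Cocycle 𝕜 H θ} {n : Q → InnerProductSpace.Core 𝕜 H}
    {N : Q → Submodule 𝕜 H} {A : Q → H →ₗ.[𝕜] H} (hN : AdmitsGrowthExponents Ξ n N)
    (hA : IsMeanRepresentation Ξ n N A) {m : ℕ} {q : Q} {ξ : Fin m → H}
    (hξ : ∀ j, ξ j ∈ N q) (s : ℝ≥0) : ℝ :=
  RCLike.re (finiteRankTrace
    (compression (n (θ s q)) (A (θ s q)) (evolvedSpan Ξ s q ξ)
      (evolvedSpan_le_domain hN hA hξ s)))

end Cocycle

end LiouvilleTrace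

end

/-! The squared volume is `det G(t) / m!`, where `G(t)` is the Gram matrix of the evolved vectors.
Polarization and the cocycle property turn the hypotheses on norms into two facts about the entries
of `G`: they are absolutely continuous, and at every time they have right derivatives `⟨A u i, u j⟩
+ ⟨u i, A u j⟩`. If the evolved vectors are independent and `M` is the matrix of the compression of
`A` to their span, then `G' = Mᴴ G + G M`, and Jacobi's formula gives `(det G)' = tr (adj G * G') =
2 det G * Re tr M` (`trace_adjugate_gramMatrix_mul`, `hasDerivWithinAt_re_det_evolvedGram`). Hence
`½ log det G` is absolutely continuous with right derivative `ρ` as long as `det G > 0`, and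
integration gives the formula (`integral_traceRate`).

A linear map cannot make dependent vectors independent, so a zero of the volume persists
(`re_det_evolvedGram_pos_of_le`). By continuity there is a first zero, and the integral diverges
there because the logarithm does. -/

/-! ### Calculus of absolutely continuous functions, and Jacobi's formula. -/

namespace AbsolutelyContinuousOnInterval

open Filter Set MeasureTheory

/-- The composition of a Lipschitz function with an absolutely continuous one is absolutely
continuous. -/
theorem lipschitzOnWith_comp {X Y : Type*} [PseudoMetricSpace X] [PseudoMetricSpace Y]
    {f : ℝ → X} {φ : X → Y} {a b : ℝ} {K : ℝ≥0} {s : Set X}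
    (hφ : LipschitzOnWith K φ s) (hf : AbsolutelyContinuousOnInterval f a b)
    (hs : MapsTo f (uIcc a b) s) : AbsolutelyContinuousOnInterval (fun t => φ (f t)) a b := by
  unfold AbsolutelyContinuousOnInterval at hf
  refine squeeze_zero' ?_ ?_ (by simpa using hf.const_mul (K : ℝ))
  · exact Eventually.of_forall fun _ => Finset.sum_nonneg fun _ _ => dist_nonneg
  · rw [eventually_inf_principal]
    filter_upwards with E hE
    rw [Finset.mul_sum]
    exact Finset.sum_le_sum fun i hi =>
      hφ.dist_le_mul _ (hs (hE.1 i hi).1) _ (hs (hE.1 i hi).2)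

theorem const {X : Type*} [PseudoMetricSpace X] (x : X) (a b : ℝ) :
    AbsolutelyContinuousOnInterval (fun _ => x) a b :=
  ((LipschitzWith.const x).lipschitzOnWith (s := uIcc a b)).absolutelyContinuousOnInterval

theorem finset_sum {F ι : Type*} [SeminormedAddCommGroup F] {f : ι → ℝ → F} {a b : ℝ}
    (s : Finset ι) (hf : ∀ i ∈ s, AbsolutelyContinuousOnInterval (f i) a b) :
    AbsolutelyContinuousOnInterval (fun t => ∑ i ∈ s, f i t) a b := by
  classical
  induction s using Finset.induction_on with
  | empty => simpa using const (0 : F) a b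
  | insert i s hi ih =>
    simp only [Finset.sum_insert hi]
    exact (hf i (Finset.mem_insert_self i s)).fun_add
      (ih fun j hj => hf j (Finset.mem_insert_of_mem hj))

theorem finset_prod {K ι : Type*} [NormedField K] {f : ι → ℝ → K} {a b : ℝ}
    (s : Finset ι) (hf : ∀ i ∈ s, AbsolutelyContinuousOnInterval (f i) a b) :
    AbsolutelyContinuousOnInterval (fun t => ∏ i ∈ s, f i t) a b := by
  classical
  induction s using Finset.induction_on with
  | empty => simpa using const (1 : K) a b
  | insert i s hi ih =>
    simp only [Finset.prod_insert hi]
    exact (hf i (Finset.mem_insert_self i s)).fun_smul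
      (ih fun j hj => hf j (Finset.mem_insert_of_mem hj))

theorem matrix_det {K ι : Type*} [NormedField K] [Fintype ι] [DecidableEq ι]
    {G : ℝ → Matrix ι ι K} {a b : ℝ}
    (hG : ∀ i j, AbsolutelyContinuousOnInterval (fun t => G t i j) a b) :
    AbsolutelyContinuousOnInterval (fun t => (G t).det) a b := by
  simp only [Matrix.det_apply']
  refine finset_sum _ fun σ _ => ?_
  exact (const (((Equiv.Perm.sign σ : ℤ) : K)) a b).fun_smul
    (finset_prod Finset.univ fun i _ => hG (σ i) i)

theorem ofReal {𝕜 : Type*} [RCLike 𝕜] {f : ℝ → ℝ} {a b : ℝ}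
    (hf : AbsolutelyContinuousOnInterval f a b) :
    AbsolutelyContinuousOnInterval (fun t => (f t : 𝕜)) a b :=
  lipschitzOnWith_comp (φ := ((↑) : ℝ → 𝕜))
    (RCLike.ofRealCLM (K := 𝕜)).lipschitz.lipschitzOnWith hf (mapsTo_univ _ _)

theorem re {𝕜 : Type*} [RCLike 𝕜] {f : ℝ → 𝕜} {a b : ℝ}
    (hf : AbsolutelyContinuousOnInterval f a b) :
    AbsolutelyContinuousOnInterval (fun t => RCLike.re (f t)) a b :=
  lipschitzOnWith_comp (φ := fun z : 𝕜 => RCLike.re z)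
    (RCLike.reCLM (K := 𝕜)).lipschitz.lipschitzOnWith hf (mapsTo_univ _ _)

/-- The logarithm of a positive absolutely continuous function is absolutely continuous. -/
theorem log {f : ℝ → ℝ} {a b : ℝ} (hf : AbsolutelyContinuousOnInterval f a b)
    (hpos : ∀ t ∈ uIcc a b, 0 < f t) :
    AbsolutelyContinuousOnInterval (fun t => Real.log (f t)) a b := by
  -- The logarithm is Lipschitz only away from `0`. The image of `f` is a compact interval of
  -- positive numbers, on which a `C¹` function is Lipschitz.
  have hcpt : IsCompact (f '' uIcc a b) := isCompact_uIcc.image_of_continuousOn hf.continuousOn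
  have hconv : Convex ℝ (f '' uIcc a b) :=
    (isPreconnected_uIcc.image f hf.continuousOn).convex
  have hlog : ContDiffOn ℝ 1 Real.log (f '' uIcc a b) := by
    refine Real.contDiffOn_log.mono ?_
    rintro _ ⟨t, ht, rfl⟩
    exact (hpos t ht).ne'
  obtain ⟨K, hK⟩ := hlog.exists_lipschitzOnWith one_ne_zero hconv hcpt
  exact lipschitzOnWith_comp hK hf (mapsTo_image f _)

/-- The fundamental theorem of calculus for an absolutely continuous function with prescribed
right derivatives. -/
theorem integral_rightDeriv_eq_sub {f ρ : ℝ → ℝ} {a b : ℝ} (hab : a ≤ b)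
    (hf : AbsolutelyContinuousOnInterval f a b)
    (hρ : ∀ x ∈ Ico a b, HasDerivWithinAt f (ρ x) (Ioi x) x) :
    IntervalIntegrable ρ volume a b ∧ ∫ x in a..b, ρ x = f b - f a := by
  -- At almost every point `f` has a two-sided derivative, which must equal the right derivative.
  -- The endpoint `b`, where no right derivative is assumed, is a null set.
  have hae : ∀ᵐ x, x ∈ Set.uIoc a b → deriv f x = ρ x := by
    filter_upwards [hf.ae_differentiableAt, Measure.ae_ne volume b] with x hx hxb hxab
    have hmem := hx (uIoc_subset_uIcc hxab)
    rw [uIoc_of_le hab] at hxab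
    exact (uniqueDiffWithinAt_Ioi x).eq_deriv _ hmem.hasDerivAt.hasDerivWithinAt
      (hρ x ⟨hxab.1.le, lt_of_le_of_ne hxab.2 hxb⟩)
  constructor
  · exact hf.intervalIntegrable_deriv.congr_ae
      ((ae_restrict_iff' measurableSet_uIoc).2 hae)
  · rw [← hf.integral_deriv_eq_sub]
    exact (intervalIntegral.integral_congr_ae hae).symm

end AbsolutelyContinuousOnInterval

/-- Jacobi's formula for the derivative of a determinant. -/
theorem Matrix.hasDerivWithinAt_det {𝕜 : Type*} [RCLike 𝕜] {ι : Type*} [Fintype ι] [DecidableEq ι]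
    {G : ℝ → Matrix ι ι 𝕜} {G' : Matrix ι ι 𝕜} {s : Set ℝ} {x : ℝ}
    (hG : ∀ i j, HasDerivWithinAt (fun t => G t i j) (G' i j) s x) :
    HasDerivWithinAt (fun t => (G t).det) ((G x).adjugate * G').trace s x := by
  have hprod : ∀ σ : Equiv.Perm ι, HasDerivWithinAt (fun t => ∏ i, G t i (σ i))
      (∑ i, (∏ j ∈ Finset.univ.erase i, G x j (σ j)) • G' i (σ i)) s x :=
    fun σ => HasDerivWithinAt.fun_finsetProd fun i _ => hG i (σ i)
  have hsum := HasDerivWithinAt.fun_sum (u := Finset.univ)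
    fun σ _ => (hprod σ).const_mul ((Equiv.Perm.sign σ : ℤ) : 𝕜)
  -- Transposing makes the Leibniz products run over rows, to match the row replacement in `hrow`.
  have hdet : (fun t => (G t).det) =
      fun t => ∑ σ : Equiv.Perm ι, ((Equiv.Perm.sign σ : ℤ) : 𝕜) * ∏ i, G t i (σ i) := by
    funext t
    rw [← Matrix.det_transpose, Matrix.det_apply']
    rfl
  rw [hdet]
  refine hsum.congr_deriv ?_
  -- Cramer's rule: the `i`-th diagonal term of the trace is the determinant with row `i`
  -- differentiated, which is the `i`-th term of the product rule.
  have hrow : ∀ i, ∑ j, (G x).adjugate j i * G' i j = ((G x).updateRow i (G' i)).det := by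
    intro i
    rw [← Matrix.cramer_transpose_apply, Matrix.cramer_eq_adjugate_mulVec, Matrix.mulVec,
      dotProduct, ← Matrix.adjugate_transpose]
    rfl
  rw [Matrix.trace_mul_comm]
  simp only [Matrix.trace, Matrix.diag, Matrix.mul_apply]
  simp only [mul_comm (G' _ _), hrow]
  simp only [Finset.mul_sum]
  rw [Finset.sum_comm]
  refine Finset.sum_congr rfl fun i _ => ?_
  rw [← Matrix.det_transpose, Matrix.det_apply']
  refine Finset.sum_congr rfl fun σ _ => ?_
  congr 1
  rw [← Finset.mul_prod_erase _ _ (Finset.mem_univ i), smul_eq_mul, mul_comm]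
  simp only [Matrix.transpose_apply, Matrix.updateRow_self]
  congr 1
  refine Finset.prod_congr rfl fun j hj => ?_
  rw [Matrix.updateRow_ne (Finset.ne_of_mem_erase hj)]

/-! ### Gram determinants, polarization and traces of compressions. -/

namespace LiouvilleTrace

section Linear

variable {𝕜 : Type*} [RCLike 𝕜] {H : Type*} [AddCommGroup H] [Module 𝕜 H]

theorem ofReal_coreNorm_sq (c : InnerProductSpace.Core 𝕜 H) (x : H) :
    ((coreNorm c x ^ 2 : ℝ) : 𝕜) = c.inner x x := by
  rw [coreNorm, Real.sq_sqrt (c.re_inner_nonneg x)]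
  exact RCLike.conj_eq_iff_re.1 (c.conj_inner_symm x x)

/-- The polarization identity for a Hermitian form. -/
theorem polarization {W : Type*} [AddCommGroup W] [Module 𝕜 W] {S : W → W → 𝕜}
    (hadd : ∀ x y z, S (x + y) z = S x z + S y z)
    (hsmul : ∀ (r : 𝕜) x y, S (r • x) y = starRingEnd 𝕜 r * S x y)
    (hsymm : ∀ x y, starRingEnd 𝕜 (S y x) = S x y) (x y : W) :
    S x y = 4⁻¹ * (S (x + y) (x + y) - S (x - y) (x - y)
      - RCLike.I * S (x + (RCLike.I : 𝕜) • y) (x + (RCLike.I : 𝕜) • y)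
      + RCLike.I * S (x - (RCLike.I : 𝕜) • y) (x - (RCLike.I : 𝕜) • y)) := by
  have hadd' : ∀ x y z, S z (x + y) = S z x + S z y := fun x y z => by
    rw [← hsymm, hadd, map_add, hsymm, hsymm]
  have hsmul' : ∀ (r : 𝕜) x y, S x (r • y) = r * S x y := fun r x y => by
    rw [← hsymm, hsmul, map_mul, hsymm, RCLike.conj_conj]
  have hneg : ∀ z, S (x - z) (x - z) = S x x - S x z - S z x + S z z := fun z => by
    rw [sub_eq_add_neg, ← neg_one_smul 𝕜 z]
    simp only [hadd, hadd', hsmul, hsmul', map_neg, map_one]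
    ring
  have h4 : (4 : 𝕜) ≠ 0 := by norm_num
  rw [hneg, hneg]
  simp only [hadd, hadd', hsmul, hsmul', RCLike.conj_I]
  -- If `I = 0`, the scalars are real: `S` is then symmetric and the two terms with factor `I` drop
  -- out.
  rcases RCLike.I_mul_I (K := 𝕜) with hI | hI
  · have him : S y x = S x y := by
      rw [← hsymm y x, RCLike.conj_eq_iff_im, ← RCLike.I_im (S x y), hI, map_zero, mul_zero]
    rw [hI, him]
    field_simp
    ring
  · field_simp
    linear_combination (2 * S x y - 2 * S y x) * hI

/-- The Gram matrix of a family of vectors with respect to the inner product `c`. -/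
def gramMatrix (c : InnerProductSpace.Core 𝕜 H) {ι : Type*} (u : ι → H) : Matrix ι ι 𝕜 :=
  Matrix.of fun i j => c.inner (u i) (u j)

theorem gramMatrix_conjTranspose (c : InnerProductSpace.Core 𝕜 H) {ι : Type*} (u : ι → H) :
    (gramMatrix c u).conjTranspose = gramMatrix c u := by
  ext i j
  exact c.conj_inner_symm (u i) (u j)

section Det

variable {ι : Type*} [Fintype ι] [DecidableEq ι]

theorem det_gramMatrix_ne_zero_iff (c : InnerProductSpace.Core 𝕜 H) (u : ι → H) :
    (gramMatrix c u).det ≠ 0 ↔ LinearIndependent 𝕜 u := by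
  let _ : NormedAddCommGroup H := c.toNormedAddCommGroup
  let _ : InnerProductSpace 𝕜 H := InnerProductSpace.ofCore c.toCore
  exact Matrix.det_gram_ne_zero_iff_linearIndependent

open scoped ComplexOrder in
theorem det_gramMatrix_nonneg (c : InnerProductSpace.Core 𝕜 H) (u : ι → H) :
    0 ≤ (gramMatrix c u).det := by
  let _ : NormedAddCommGroup H := c.toNormedAddCommGroup
  let _ : InnerProductSpace 𝕜 H := InnerProductSpace.ofCore c.toCore
  exact (Matrix.posSemidef_gram 𝕜 u).det_nonneg

theorem re_det_gramMatrix_nonneg (c : InnerProductSpace.Core 𝕜 H) (u : ι → H) :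
    0 ≤ RCLike.re (gramMatrix c u).det :=
  (RCLike.nonneg_iff.1 (det_gramMatrix_nonneg c u)).1

/-- Nonnegativity in the complex order includes a vanishing imaginary part, so nothing is lost by
working with the real function `re det`. -/
theorem ofReal_re_det_gramMatrix (c : InnerProductSpace.Core 𝕜 H) (u : ι → H) :
    ((RCLike.re (gramMatrix c u).det : ℝ) : 𝕜) = (gramMatrix c u).det :=
  RCLike.conj_eq_iff_re.1
    (RCLike.conj_eq_iff_im.2 (RCLike.nonneg_iff.1 (det_gramMatrix_nonneg c u)).2)

theorem re_det_gramMatrix_pos_iff (c : InnerProductSpace.Core 𝕜 H) (u : ι → H) :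
    0 < RCLike.re (gramMatrix c u).det ↔ LinearIndependent 𝕜 u := by
  rw [← det_gramMatrix_ne_zero_iff c, (re_det_gramMatrix_nonneg c u).lt_iff_ne, ne_comm,
    ← ofReal_re_det_gramMatrix c u]
  simp

end Det

theorem wedgeNorm_ιMulti (c : InnerProductSpace.Core 𝕜 H) {m : ℕ} (u : Fin m → H) :
    wedgeNorm c m (exteriorPower.ιMulti 𝕜 m u) =
      Real.sqrt ((m.factorial : ℝ)⁻¹ * RCLike.re (gramMatrix c u).det) := by
  -- `wedgeInner_ιMulti` produces the transpose of the Gram matrix.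
  have hdet : Matrix.det (Matrix.of fun i j => c.inner (u j) (u i)) = (gramMatrix c u).det :=
    Matrix.det_transpose (gramMatrix c u)
  have hfact : ((m.factorial : 𝕜))⁻¹ = (((m.factorial : ℝ)⁻¹ : ℝ) : 𝕜) := by simp
  rw [wedgeNorm, wedgeInner_ιMulti, hdet, hfact, RCLike.re_ofReal_mul]

/-- The trace of a linear operator of finite rank can be computed on any finite-dimensional
subspace containing its range. -/
theorem finiteRankTrace_eq_trace_restrict (T : H →ₗ[𝕜] H) (L : Submodule 𝕜 H)
    [FiniteDimensional 𝕜 L] (hT : ∀ x, T x ∈ L) :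
    finiteRankTrace T = LinearMap.trace 𝕜 L (T.restrict (p := L) (q := L) fun x _ => hT x) := by
  have hle : LinearMap.range T ≤ L := by
    rintro _ ⟨x, rfl⟩
    exact hT x
  -- `T` maps `L` into its range, so the rest of `L` contributes nothing to the trace.
  have hmem : ∀ x : L, (T.restrict (p := L) (q := L) fun x _ => hT x) x ∈
      (LinearMap.range T).comap L.subtype := fun x => LinearMap.mem_range_self T (x : H)
  rw [← LinearMap.trace_restrict_eq_of_forall_mem _ _ hmem, finiteRankTrace,
    ← LinearMap.trace_conj' _ (Submodule.comapSubtypeEquivOfLe hle)]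
  rfl

theorem orthProj_eq_self (c : InnerProductSpace.Core 𝕜 H) (L : Submodule 𝕜 H)
    [FiniteDimensional 𝕜 L] {x : H} (hx : x ∈ L) : orthProj c L x = x := by
  let _ : NormedAddCommGroup H := c.toNormedAddCommGroup
  let _ : InnerProductSpace 𝕜 H := InnerProductSpace.ofCore c.toCore
  exact Submodule.starProjection_eq_self_iff.2 hx

theorem inner_orthProj (c : InnerProductSpace.Core 𝕜 H) (L : Submodule 𝕜 H)
    [FiniteDimensional 𝕜 L] (x : H) {y : H} (hy : y ∈ L) :
    c.inner y (orthProj c L x) = c.inner y x := by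
  have h := congrArg (starRingEnd 𝕜) (inner_sub_orthProj c L x y hy)
  rw [c.conj_inner_symm, map_zero] at h
  have h' : innerDual c y (x - orthProj c L x) = 0 := h
  rw [map_sub, sub_eq_zero] at h'
  exact h'.symm

theorem compression_apply_of_mem (c : InnerProductSpace.Core 𝕜 H) (A : H →ₗ.[𝕜] H)
    (L : Submodule 𝕜 H) [FiniteDimensional 𝕜 L] (hL : L ≤ A.domain) {x : H} (hx : x ∈ L) :
    compression c A L hL x = orthProj c L (A ⟨x, hL hx⟩) := by
  have hsub : (orthProj c L).codRestrict A.domain (fun y => hL (orthProj_mem c L y)) x =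
      ⟨x, hL hx⟩ := Subtype.ext (orthProj_eq_self c L hx)
  exact congrArg (fun z => orthProj c L (A z)) hsub

/-- The matrix of the compression of `A` to the span of linearly independent vectors `u`. -/
theorem exists_matrix_compression (c : InnerProductSpace.Core 𝕜 H) (A : H →ₗ.[𝕜] H)
    {ι : Type*} [Fintype ι] [DecidableEq ι] {u : ι → H} (hu : LinearIndependent 𝕜 u)
    [FiniteDimensional 𝕜 (Submodule.span 𝕜 (Set.range u))]
    (hL : Submodule.span 𝕜 (Set.range u) ≤ A.domain)
    (hmem : ∀ i, u i ∈ A.domain) :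
    ∃ M : Matrix ι ι 𝕜,
      finiteRankTrace (compression c A (Submodule.span 𝕜 (Set.range u)) hL) = M.trace ∧
      ∀ i j, c.inner (u i) (A ⟨u j, hmem j⟩) = (gramMatrix c u * M) i j := by
  set L := Submodule.span 𝕜 (Set.range u) with hLdef
  have huL : ∀ i, u i ∈ L := fun i => Submodule.subset_span ⟨i, rfl⟩
  have hT : ∀ x, compression c A L hL x ∈ L := fun x => orthProj_mem c L _
  set TL := (compression c A L hL).restrict (p := L) (q := L) fun x _ => hT x with hTL
  let b : Module.Basis ι 𝕜 L := Module.Basis.span hu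
  have hb : ∀ i, (b i : H) = u i := fun i => congrArg Subtype.val (Module.Basis.span_apply hu i)
  refine ⟨LinearMap.toMatrix b b TL, ?_, fun i j => ?_⟩
  · rw [finiteRankTrace_eq_trace_restrict _ L hT, LinearMap.trace_eq_matrix_trace 𝕜 b]
  · have hsum : (TL (b j) : H) = ∑ k, LinearMap.toMatrix b b TL k j • u k := by
      have h := congrArg Subtype.val (b.sum_repr (TL (b j)))
      rw [← h, Submodule.coe_sum]
      refine Finset.sum_congr rfl fun k _ => ?_
      rw [Submodule.coe_smul, hb, LinearMap.toMatrix_apply]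
    have hTj : (TL (b j) : H) = orthProj c L (A ⟨u j, hmem j⟩) := by
      change compression c A L hL (b j : H) = _
      rw [hb, compression_apply_of_mem c A L hL (huL j)]
    -- Pairing with `u i ∈ L` does not see the projector, so `A` and its compression give the same
    -- entries.
    rw [← inner_orthProj c L _ (huL i), ← hTj, hsum]
    change innerDual c (u i) _ = _
    rw [map_sum, Matrix.mul_apply]
    refine Finset.sum_congr rfl fun k _ => ?_
    rw [map_smul, smul_eq_mul, mul_comm]
    rfl

/-- If `u` is linearly independent and the matrix `G'` has the entries
`⟨u i, A u j⟩ + ⟨A u i, u j⟩`, then `tr (adj G * G')` is twice the determinant of the Gram matrix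
`G` times the real part of the trace of the compression of `A` to the span of `u`. -/
theorem trace_adjugate_gramMatrix_mul (c : InnerProductSpace.Core 𝕜 H) (A : H →ₗ.[𝕜] H)
    {ι : Type*} [Fintype ι] [DecidableEq ι] {u : ι → H} (hu : LinearIndependent 𝕜 u)
    [FiniteDimensional 𝕜 (Submodule.span 𝕜 (Set.range u))]
    (hL : Submodule.span 𝕜 (Set.range u) ≤ A.domain)
    (hmem : ∀ i, u i ∈ A.domain) :
    ((gramMatrix c u).adjugate * Matrix.of fun i j =>
        c.inner (A ⟨u i, hmem i⟩) (u j) + c.inner (u i) (A ⟨u j, hmem j⟩)).trace =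
      (gramMatrix c u).det * ((2 * RCLike.re (finiteRankTrace
        (compression c A (Submodule.span 𝕜 (Set.range u)) hL)) : ℝ) : 𝕜) := by
  obtain ⟨M, htr, hM⟩ := exists_matrix_compression c A hu hL hmem
  have hG' : (Matrix.of fun i j =>
      c.inner (A ⟨u i, hmem i⟩) (u j) + c.inner (u i) (A ⟨u j, hmem j⟩)) =
      M.conjTranspose * gramMatrix c u + gramMatrix c u * M := by
    have hconj : M.conjTranspose * gramMatrix c u = (gramMatrix c u * M).conjTranspose := by
      rw [Matrix.conjTranspose_mul, gramMatrix_conjTranspose]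
    ext i j
    rw [hconj, Matrix.add_apply, Matrix.conjTranspose_apply, ← hM, ← hM, Matrix.of_apply,
      ← c.conj_inner_symm (A ⟨u i, hmem i⟩) (u j)]
    rfl
  -- Cyclicity of the trace brings `adj G` next to `G` in both terms. They become `det G` times `tr
  -- Mᴴ` and `tr M`, whose sum is `2 Re tr M`.
  rw [hG', Matrix.mul_add, Matrix.trace_add, ← Matrix.mul_assoc, ← Matrix.mul_assoc,
    Matrix.trace_mul_comm _ (gramMatrix c u), ← Matrix.mul_assoc, Matrix.mul_adjugate,
    Matrix.adjugate_mul, Matrix.smul_mul, Matrix.smul_mul, Matrix.one_mul, Matrix.one_mul,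
    Matrix.trace_smul, Matrix.trace_smul, Matrix.trace_conjTranspose, htr, smul_eq_mul,
    smul_eq_mul, ← mul_add]
  congr 1
  rw [add_comm]
  rw [RCLike.ofReal_mul, RCLike.ofReal_ofNat]
  exact RCLike.add_conj M.trace

end Linear

end LiouvilleTrace

/-! ### Evolution of inner products and Gram determinants along the cocycle. -/

namespace LiouvilleTrace

section Evolution

open Set Filter

variable {𝕜 : Type*} [RCLike 𝕜] {H : Type*} [NormedAddCommGroup H] [InnerProductSpace 𝕜 H]
  {Q : Type*} [MetricSpace Q] {θ : Flow ℝ≥0 Q}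

/-- The inner product of two vectors evolved for the time `t`. -/
noncomputable def evolvedInner (Ξ : Cocycle 𝕜 H θ) (n : Q → InnerProductSpace.Core 𝕜 H) (q : Q)
    (x y : H) (t : ℝ) : 𝕜 :=
  (n (θ t.toNNReal q)).inner (Ξ.toFun t.toNNReal q x) (Ξ.toFun t.toNNReal q y)

/-- The Gram matrix of a family of vectors evolved for the time `t`. -/
noncomputable def evolvedGram (Ξ : Cocycle 𝕜 H θ) (n : Q → InnerProductSpace.Core 𝕜 H) (q : Q)
    {m : ℕ} (ξ : Fin m → H) (t : ℝ) : Matrix (Fin m) (Fin m) 𝕜 :=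
  gramMatrix (n (θ t.toNNReal q)) fun j => Ξ.toFun t.toNNReal q (ξ j)

variable {Ξ : Cocycle 𝕜 H θ} {n : Q → InnerProductSpace.Core 𝕜 H}
  {N : Q → Submodule 𝕜 H} {A : Q → H →ₗ.[𝕜] H} {q : Q}

theorem evolvedInner_zero (x y : H) : evolvedInner Ξ n q x y 0 = (n q).inner x y := by
  rw [evolvedInner, Real.toNNReal_zero, Ξ.map_zero, Ξ.map_zero, θ.map_zero_apply]

/-- The cocycle property, in the form that reduces a right derivative at time `s` to one at time `0`
over the base point `θ s q`. -/
theorem evolvedInner_add {s h : ℝ} (hs : 0 ≤ s) (hh : 0 ≤ h) (x y : H) :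
    evolvedInner Ξ n q x y (h + s) = evolvedInner Ξ n (θ s.toNNReal q)
      (Ξ.toFun s.toNNReal q x) (Ξ.toFun s.toNNReal q y) h := by
  rw [evolvedInner, Real.toNNReal_add hh hs, Ξ.map_add, Ξ.map_add, θ.map_add]
  rfl

theorem evolvedInner_self (x : H) (t : ℝ) : evolvedInner Ξ n q x x t =
    ((coreNorm (n (θ t.toNNReal q)) (Ξ.toFun t.toNNReal q x) ^ 2 : ℝ) : 𝕜) :=
  (ofReal_coreNorm_sq _ _).symm

/-- The polarization identity along the evolution. -/
theorem evolvedInner_polarization (x y : H) (t : ℝ) :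
    evolvedInner Ξ n q x y t = 4⁻¹ * (evolvedInner Ξ n q (x + y) (x + y) t
      - evolvedInner Ξ n q (x - y) (x - y) t
      - RCLike.I * evolvedInner Ξ n q (x + (RCLike.I : 𝕜) • y) (x + (RCLike.I : 𝕜) • y) t
      + RCLike.I * evolvedInner Ξ n q (x - (RCLike.I : 𝕜) • y) (x - (RCLike.I : 𝕜) • y) t) := by
  refine polarization (S := fun x y => evolvedInner Ξ n q x y t) ?_ ?_ ?_ x y
  · intro x y z
    simp only [evolvedInner, map_add]
    exact (n _).add_left _ _ _
  · intro r x y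
    simp only [evolvedInner, map_smul]
    exact (n _).smul_left _ _ _
  · exact fun x y => (n _).conj_inner_symm _ _

/-- The hypothesis concerns norms of single vectors. Squaring settles the diagonal case, and
polarization the general one, since `N q` is a subspace. -/
theorem absolutelyContinuousOnInterval_evolvedInner (hN : AdmitsGrowthExponents Ξ n N)
    {x y : H} (hx : x ∈ N q) (hy : y ∈ N q) {T : ℝ} (hT : 0 < T) :
    AbsolutelyContinuousOnInterval (evolvedInner Ξ n q x y) 0 T := by
  have hself : ∀ z ∈ N q, AbsolutelyContinuousOnInterval (evolvedInner Ξ n q z z) 0 T := by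
    intro z hz
    have h := hN.absolutelyContinuous q z hz T hT
    have h2 := (h.fun_mul h).ofReal (𝕜 := 𝕜)
    simp only [← sq, ← evolvedInner_self] at h2
    exact h2
  have hIy := (N q).smul_mem (RCLike.I : 𝕜) hy
  have h := ((((hself _ (add_mem hx hy)).fun_sub (hself _ (sub_mem hx hy))).fun_sub
    ((hself _ (add_mem hx hIy)).const_smul (RCLike.I : 𝕜))).fun_add
    ((hself _ (sub_mem hx hIy)).const_smul (RCLike.I : 𝕜))).const_smul (4⁻¹ : 𝕜)
  simp only [smul_eq_mul, ← evolvedInner_polarization] at h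
  exact h

/-- `curvatureForm` is a `limUnder`, meaningful only when the limit exists. Existence comes from the
right derivative of the norm by squaring; only then is the value identified through `form_eq`. -/
theorem hasDerivWithinAt_evolvedInner_self_zero (hN : AdmitsGrowthExponents Ξ n N)
    (hA : IsMeanRepresentation Ξ n N A) {x : H} (hx : x ∈ N q) :
    HasDerivWithinAt (evolvedInner Ξ n q x x)
      (2 * ((RCLike.re ((n q).inner (A q ⟨x, hA.le_domain q hx⟩) x) : ℝ) : 𝕜)) (Ioi 0) 0 := by
  obtain ⟨D, hD⟩ := hN.rightDeriv q x hx
  have hnorm : HasDerivWithinAt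
      (fun t : ℝ => coreNorm (n (θ t.toNNReal q)) (Ξ.toFun t.toNNReal q x)) D (Ioi 0) 0 := by
    rw [hasDerivWithinAt_iff_tendsto_slope' self_notMem_Ioi]
    refine hD.congr fun t => ?_
    simp only [slope_def_field, sub_zero, Real.toNNReal_zero, Ξ.map_zero, θ.map_zero_apply]
  have hsq := (RCLike.ofRealCLM (K := 𝕜)).hasFDerivAt.comp_hasDerivWithinAt _ (hnorm.fun_pow 2)
  have hself : HasDerivWithinAt (evolvedInner Ξ n q x x) _ (Ioi 0) 0 :=
    hsq.congr (fun t _ => evolvedInner_self x t) (evolvedInner_self x 0)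
  refine hself.congr_deriv ?_
  rw [hasDerivWithinAt_iff_tendsto_slope' self_notMem_Ioi] at hself
  have hlim := hself.limUnder_eq
  rw [← hA.form_eq q x hx, curvatureForm, ← mul_assoc, mul_inv_cancel₀ two_ne_zero, one_mul,
    ← hlim]
  congr 1
  funext t
  rw [slope_def_module, evolvedInner_zero, sub_zero, RCLike.real_smul_eq_coe_mul, div_eq_inv_mul,
    RCLike.ofReal_inv]
  rfl

/-- The right derivative of the inner product along the evolution, for equal vectors. -/
theorem hasDerivWithinAt_evolvedInner_self (hN : AdmitsGrowthExponents Ξ n N)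
    (hA : IsMeanRepresentation Ξ n N A) {x : H} (hx : x ∈ N q) {s : ℝ} (hs : 0 ≤ s)
    (hmem : Ξ.toFun s.toNNReal q x ∈ (A (θ s.toNNReal q)).domain) :
    HasDerivWithinAt (evolvedInner Ξ n q x x)
      (2 * ((RCLike.re ((n (θ s.toNNReal q)).inner
        (A (θ s.toNNReal q) ⟨Ξ.toFun s.toNNReal q x, hmem⟩) (Ξ.toFun s.toNNReal q x)) : ℝ) : 𝕜))
      (Ioi s) s := by
  have h0 := hasDerivWithinAt_evolvedInner_self_zero hN hA (hN.invariant s.toNNReal q x hx)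
  have hshift : HasDerivWithinAt (fun t : ℝ => t - s) 1 (Ioi s) s :=
    (hasDerivWithinAt_id s _).sub_const s
  -- Writing `0` as `s - s` lets the chain rule apply to the translation `t ↦ t - s`.
  rw [← sub_self s] at h0
  have h := HasDerivWithinAt.scomp (h := fun t : ℝ => t - s) s h0 hshift
    fun t ht => sub_lt_sub_right (mem_Ioi.1 ht) s
  rw [one_smul] at h
  refine h.congr (fun t ht => ?_) ?_
  · conv_lhs => rw [← sub_add_cancel t s]
    exact evolvedInner_add hs (sub_nonneg.2 (le_of_lt ht)) x x
  · conv_lhs => rw [← sub_add_cancel s s]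
    exact evolvedInner_add hs (sub_nonneg.2 le_rfl) x x

/-- The right derivative of the inner product along the evolution. -/
theorem hasDerivWithinAt_evolvedInner (hN : AdmitsGrowthExponents Ξ n N)
    (hA : IsMeanRepresentation Ξ n N A) {s : ℝ} (hs : 0 ≤ s)
    (hmem : ∀ x ∈ N q, Ξ.toFun s.toNNReal q x ∈ (A (θ s.toNNReal q)).domain)
    {x y : H} (hx : x ∈ N q) (hy : y ∈ N q) :
    HasDerivWithinAt (evolvedInner Ξ n q x y)
      ((n (θ s.toNNReal q)).inner (A (θ s.toNNReal q) ⟨Ξ.toFun s.toNNReal q x, hmem x hx⟩)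
          (Ξ.toFun s.toNNReal q y) +
        (n (θ s.toNNReal q)).inner (Ξ.toFun s.toNNReal q x)
          (A (θ s.toNNReal q) ⟨Ξ.toFun s.toNNReal q y, hmem y hy⟩)) (Ioi s) s := by
  set c := n (θ s.toNNReal q) with hc
  let U : N q →ₗ[𝕜] H := (Ξ.toFun s.toNNReal q).toLinearMap ∘ₗ (N q).subtype
  let V : N q →ₗ[𝕜] H := (A (θ s.toNNReal q)).toFun ∘ₗ
    U.codRestrict (A (θ s.toNNReal q)).domain fun z => hmem z z.2
  -- The mean representation controls only the diagonal. There `S` is `2 Re ⟨z, A z⟩`, and `S` is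
  -- Hermitian, so polarizing both `S` and the evolved inner product gives the mixed derivatives.
  let S : N q → N q → 𝕜 := fun z w => c.inner (V z) (U w) + c.inner (U z) (V w)
  have hS : ∀ z w, S z w = _ := polarization (S := S)
    (fun x y z => by
      simp only [S, map_add]
      rw [c.add_left, c.add_left]
      ring)
    (fun r x y => by
      simp only [S, map_smul]
      rw [c.smul_left, c.smul_left]
      ring)
    (fun x y => by
      simp only [S, map_add]
      rw [c.conj_inner_symm, c.conj_inner_symm, add_comm])
  have hself : ∀ z : N q, HasDerivWithinAt (evolvedInner Ξ n q (z : H) (z : H)) (S z z)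
      (Ioi s) s := by
    intro z
    refine (hasDerivWithinAt_evolvedInner_self hN hA z.2 hs (hmem z z.2)).congr_deriv ?_
    change _ = c.inner (V z) (U z) + c.inner (U z) (V z)
    rw [← c.conj_inner_symm (U z) (V z)]
    exact (RCLike.add_conj _).symm
  let X : N q := ⟨x, hx⟩
  let Y : N q := ⟨y, hy⟩
  have h := (((((hself (X + Y)).fun_sub (hself (X - Y))).fun_sub
    ((hself (X + (RCLike.I : 𝕜) • Y)).const_mul (RCLike.I : 𝕜))).fun_add
    ((hself (X - (RCLike.I : 𝕜) • Y)).const_mul (RCLike.I : 𝕜))).const_mul (4⁻¹ : 𝕜))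
  rw [← hS X Y] at h
  exact h.congr (fun t _ => evolvedInner_polarization x y t) (evolvedInner_polarization x y s)

theorem evolvedVolume_eq {m : ℕ} (ξ : Fin m → H) (t : ℝ≥0) :
    evolvedVolume Ξ n t q ξ =
      Real.sqrt ((m.factorial : ℝ)⁻¹ * RCLike.re (evolvedGram Ξ n q ξ t).det) := by
  rw [evolvedVolume, Cocycle.compound, exteriorPower.map_apply_ιMulti, wedgeNorm_ιMulti,
    evolvedGram, Real.toNNReal_coe]
  rfl

theorem re_det_evolvedGram_nonneg {m : ℕ} (ξ : Fin m → H) (t : ℝ) :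
    0 ≤ RCLike.re (evolvedGram Ξ n q ξ t).det :=
  re_det_gramMatrix_nonneg _ _

theorem re_det_evolvedGram_pos_iff {m : ℕ} (ξ : Fin m → H) (t : ℝ) :
    0 < RCLike.re (evolvedGram Ξ n q ξ t).det ↔
      LinearIndependent 𝕜 fun j => Ξ.toFun t.toNNReal q (ξ j) :=
  re_det_gramMatrix_pos_iff _ _

/-- The vectors at time `t` are linear images of those at time `s`, so independence at `t` forces
independence at `s`. -/
theorem re_det_evolvedGram_pos_of_le {m : ℕ} {ξ : Fin m → H} {s t : ℝ} (hst : s ≤ t)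
    (ht : 0 < RCLike.re (evolvedGram Ξ n q ξ t).det) :
    0 < RCLike.re (evolvedGram Ξ n q ξ s).det := by
  rw [re_det_evolvedGram_pos_iff] at ht ⊢
  have hle : s.toNNReal ≤ t.toNNReal := Real.toNNReal_le_toNNReal hst
  have hfun : (fun j => Ξ.toFun t.toNNReal q (ξ j)) =
      (Ξ.toFun (t.toNNReal - s.toNNReal) (θ s.toNNReal q)).toLinearMap ∘
        fun j => Ξ.toFun s.toNNReal q (ξ j) := by
    funext j
    change _ = Ξ.toFun (t.toNNReal - s.toNNReal) (θ s.toNNReal q) (Ξ.toFun s.toNNReal q (ξ j))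
    rw [← Ξ.map_add, tsub_add_cancel_of_le hle]
  rw [hfun] at ht
  exact ht.of_comp _

theorem evolvedVolume_eq_zero_iff {m : ℕ} (ξ : Fin m → H) (t : ℝ≥0) :
    evolvedVolume Ξ n t q ξ = 0 ↔ RCLike.re (evolvedGram Ξ n q ξ t).det = 0 := by
  have hfact : (0 : ℝ) < (m.factorial : ℝ)⁻¹ := by positivity
  rw [evolvedVolume_eq, Real.sqrt_eq_zero
    (mul_nonneg hfact.le (re_det_evolvedGram_nonneg ξ t)), mul_eq_zero]
  simp [hfact.ne']

theorem evolvedVolume_zero {m : ℕ} (ξ : Fin m → H) :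
    evolvedVolume Ξ n 0 q ξ = wedgeNorm (n q) m (exteriorPower.ιMulti 𝕜 m ξ) := by
  rw [evolvedVolume, Cocycle.compound, exteriorPower.map_apply_ιMulti, θ.map_zero_apply]
  congr 2
  funext j
  exact Ξ.map_zero q (ξ j)

theorem absolutelyContinuousOnInterval_re_det_evolvedGram (hN : AdmitsGrowthExponents Ξ n N)
    {m : ℕ} {ξ : Fin m → H} (hξ : ∀ j, ξ j ∈ N q) {T : ℝ} (hT : 0 ≤ T) :
    AbsolutelyContinuousOnInterval (fun t => RCLike.re (evolvedGram Ξ n q ξ t).det) 0 T := by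
  -- Growth exponents give absolute continuity only on intervals of positive length, and `T` may be
  -- `0`; hence `T + 1`.
  refine AbsolutelyContinuousOnInterval.mono (a := 0) (b := T + 1)
    (AbsolutelyContinuousOnInterval.matrix_det fun i j =>
      absolutelyContinuousOnInterval_evolvedInner hN (hξ i) (hξ j) (by linarith)).re ?_
  rw [uIcc_of_le hT, uIcc_of_le (by linarith)]
  exact Icc_subset_Icc le_rfl (by linarith)

/-- The infinitesimal Liouville formula. -/
theorem hasDerivWithinAt_re_det_evolvedGram (hN : AdmitsGrowthExponents Ξ n N)
    (hA : IsMeanRepresentation Ξ n N A) {m : ℕ} {ξ : Fin m → H} (hξ : ∀ j, ξ j ∈ N q)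
    {s : ℝ} (hs : 0 ≤ s) (hpos : 0 < RCLike.re (evolvedGram Ξ n q ξ s).det) :
    HasDerivWithinAt (fun t => RCLike.re (evolvedGram Ξ n q ξ t).det)
      (RCLike.re (evolvedGram Ξ n q ξ s).det * (2 * traceRate hN hA hξ s.toNNReal))
      (Ioi s) s := by
  have hmem : ∀ x ∈ N q, Ξ.toFun s.toNNReal q x ∈ (A (θ s.toNNReal q)).domain :=
    fun x hx => hA.le_domain _ (hN.invariant _ q x hx)
  have hdet := Matrix.hasDerivWithinAt_det (G := evolvedGram Ξ n q ξ)
    (G' := Matrix.of fun i j => _) fun i j =>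
      hasDerivWithinAt_evolvedInner hN hA hs hmem (hξ i) (hξ j)
  have : FiniteDimensional 𝕜
      (Submodule.span 𝕜 (range fun j => Ξ.toFun s.toNNReal q (ξ j))) :=
    FiniteDimensional.span_of_finite 𝕜 (finite_range _)
  -- Positivity of the determinant enters here, as independence of the evolved vectors.
  have htr := trace_adjugate_gramMatrix_mul (n (θ s.toNNReal q)) (A (θ s.toNNReal q))
    ((re_det_evolvedGram_pos_iff ξ s).1 hpos) (evolvedSpan_le_domain hN hA hξ s.toNNReal)
    fun j => hmem _ (hξ j)
  have hdet' := hdet.congr_deriv htr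
  have hre := (RCLike.reCLM (K := 𝕜)).hasFDerivAt.comp_hasDerivWithinAt _ hdet'
  refine hre.congr_deriv ?_
  change RCLike.re (_ * ((_ : ℝ) : 𝕜)) = _
  rw [RCLike.re_mul_ofReal]
  rfl

/-- The Liouville formula in logarithmic form. -/
theorem integral_traceRate (hN : AdmitsGrowthExponents Ξ n N)
    (hA : IsMeanRepresentation Ξ n N A) {m : ℕ} {ξ : Fin m → H} (hξ : ∀ j, ξ j ∈ N q)
    {t : ℝ} (ht : 0 ≤ t) (hpos : 0 < RCLike.re (evolvedGram Ξ n q ξ t).det) :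
    IntervalIntegrable (fun s : ℝ => traceRate hN hA hξ s.toNNReal) MeasureTheory.volume 0 t ∧
    ∫ s in (0 : ℝ)..t, traceRate hN hA hξ s.toNNReal =
      2⁻¹ * Real.log (RCLike.re (evolvedGram Ξ n q ξ t).det) -
        2⁻¹ * Real.log (RCLike.re (evolvedGram Ξ n q ξ 0).det) := by
  have hpos' : ∀ s ≤ t, 0 < RCLike.re (evolvedGram Ξ n q ξ s).det :=
    fun s hst => re_det_evolvedGram_pos_of_le hst hpos
  -- The factor `½` is the square root relating the volume to the Gram determinant; it cancels the
  -- `2` in the derivative of the determinant.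
  have hac := ((absolutelyContinuousOnInterval_re_det_evolvedGram hN hξ ht).log
    (fun s hs => hpos' s (uIcc_of_le ht ▸ hs).2)).const_mul 2⁻¹
  refine hac.integral_rightDeriv_eq_sub ht fun s hs => ?_
  have hder := ((hasDerivWithinAt_re_det_evolvedGram hN hA hξ hs.1 (hpos' s hs.2.le)).log
    (hpos' s hs.2.le).ne').const_mul (2⁻¹ : ℝ)
  refine hder.congr_deriv ?_
  have := (hpos' s hs.2.le).ne'
  field_simp

end Evolution

end LiouvilleTrace

/-! ### The trace formula and the first vanishing time. -/

namespace LiouvilleTrace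

section Main

open Set Filter

variable {𝕜 : Type*} [RCLike 𝕜] {H : Type*} [NormedAddCommGroup H] [InnerProductSpace 𝕜 H]
  {Q : Type*} [MetricSpace Q] {θ : Flow ℝ≥0 Q} {Ξ : Cocycle 𝕜 H θ}
  {n : Q → InnerProductSpace.Core 𝕜 H} {N : Q → Submodule 𝕜 H} {A : Q → H →ₗ.[𝕜] H} {q : Q}

/-- The Liouville trace formula, as long as the volume has not vanished. -/
theorem evolvedVolume_eq_mul_exp (hN : AdmitsGrowthExponents Ξ n N)
    (hA : IsMeanRepresentation Ξ n N A) {m : ℕ} {ξ : Fin m → H} (hξ : ∀ j, ξ j ∈ N q)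
    {t : ℝ≥0} (hpos : 0 < RCLike.re (evolvedGram Ξ n q ξ t).det) :
    evolvedVolume Ξ n t q ξ = evolvedVolume Ξ n 0 q ξ *
      Real.exp (∫ s in (0 : ℝ)..t, traceRate hN hA hξ s.toNNReal) := by
  have hpos₀ : 0 < RCLike.re (evolvedGram Ξ n q ξ (0 : ℝ)).det :=
    re_det_evolvedGram_pos_of_le t.coe_nonneg hpos
  have hexp : ∀ x : ℝ, 0 < x → Real.exp (2⁻¹ * Real.log x) = Real.sqrt x := by
    intro x hx
    rw [mul_comm, ← Real.rpow_def_of_pos hx, Real.sqrt_eq_rpow, one_div]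
  have hfact : (0 : ℝ) ≤ (m.factorial : ℝ)⁻¹ := by positivity
  rw [(integral_traceRate hN hA hξ t.coe_nonneg hpos).2, Real.exp_sub, hexp _ hpos, hexp _ hpos₀,
    evolvedVolume_eq, evolvedVolume_eq, NNReal.coe_zero, Real.sqrt_mul hfact,
    Real.sqrt_mul hfact, mul_assoc, mul_div_cancel₀ _ (Real.sqrt_pos.2 hpos₀).ne']

/-- If a nonzero volume evolves to zero, then it vanishes exactly from some first time on. -/
theorem exists_first_zero (hN : AdmitsGrowthExponents Ξ n N) {m : ℕ} {ξ : Fin m → H}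
    (hξ : ∀ j, ξ j ∈ N q) (hpos₀ : 0 < RCLike.re (evolvedGram Ξ n q ξ 0).det) {t : ℝ}
    (ht : 0 ≤ t) (hzero : RCLike.re (evolvedGram Ξ n q ξ t).det = 0) :
    ∃ t₀ : ℝ, 0 < t₀ ∧ t₀ ≤ t ∧
      ∀ s, 0 ≤ s → (RCLike.re (evolvedGram Ξ n q ξ s).det = 0 ↔ t₀ ≤ s) := by
  set D : ℝ → ℝ := fun s => RCLike.re (evolvedGram Ξ n q ξ s).det
  have hcont : ContinuousOn D (Icc 0 t) := by
    have h := (absolutelyContinuousOnInterval_re_det_evolvedGram hN hξ ht).continuousOn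
    rwa [uIcc_of_le ht] at h
  -- Compactness makes the infimum of the zeros itself a zero.
  have hcpt : IsCompact (Icc 0 t ∩ D ⁻¹' {0}) :=
    isCompact_Icc.of_isClosed_subset
      (hcont.preimage_isClosed_of_isClosed isClosed_Icc isClosed_singleton) inter_subset_left
  have hmem := hcpt.sInf_mem ⟨t, ⟨ht, le_rfl⟩, hzero⟩
  set t₀ := sInf (Icc 0 t ∩ D ⁻¹' {0})
  have hD₀ : D t₀ = 0 := hmem.2
  refine ⟨t₀, lt_of_le_of_ne hmem.1.1 fun h => ?_, hmem.1.2, fun s hs => ⟨fun h => ?_, fun h => ?_⟩⟩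
  · rw [← h] at hD₀
    exact hpos₀.ne' hD₀
  · rcases le_total s t with hst | hst
    · exact csInf_le hcpt.bddBelow ⟨⟨hs, hst⟩, h⟩
    · exact hmem.1.2.trans hst
  · by_contra hne
    exact (re_det_evolvedGram_pos_of_le h
      ((re_det_evolvedGram_nonneg ξ s).lt_of_ne' hne)).ne' hD₀

/-- The integral of the trace diverges to `-∞` at the first time at which the volume vanishes. -/
theorem tendsto_integral_traceRate_atBot (hN : AdmitsGrowthExponents Ξ n N)
    (hA : IsMeanRepresentation Ξ n N A) {m : ℕ} {ξ : Fin m → H} (hξ : ∀ j, ξ j ∈ N q)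
    {t₀ : ℝ} (ht₀ : 0 < t₀)
    (hzero : ∀ s, 0 ≤ s → (RCLike.re (evolvedGram Ξ n q ξ s).det = 0 ↔ t₀ ≤ s)) :
    Tendsto (fun r : ℝ => ∫ s in (0 : ℝ)..r, traceRate hN hA hξ s.toNNReal)
      (𝓝[<] t₀) atBot := by
  have hmem : ∀ᶠ r in 𝓝[<] t₀, r ∈ Ioo 0 t₀ := Ioo_mem_nhdsLT ht₀
  have hpos : ∀ r ∈ Ioo 0 t₀, 0 < RCLike.re (evolvedGram Ξ n q ξ r).det := fun r hr =>
    (re_det_evolvedGram_nonneg ξ r).lt_of_ne' fun h => ((hzero r hr.1.le).1 h).not_gt hr.2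
  have hcont := (absolutelyContinuousOnInterval_re_det_evolvedGram hN hξ ht₀.le).continuousOn
    t₀ right_mem_uIcc
  rw [ContinuousWithinAt, uIcc_of_le ht₀.le, (hzero t₀ ht₀.le).2 le_rfl] at hcont
  -- The determinant tends to `0` through positive values, as divergence of its logarithm to `-∞`
  -- requires.
  have hlim : Tendsto (fun r => RCLike.re (evolvedGram Ξ n q ξ r).det) (𝓝[<] t₀) (𝓝[>] 0) := by
    refine tendsto_nhdsWithin_iff.2 ⟨hcont.mono_left ?_, hmem.mono hpos⟩
    rw [← nhdsWithin_Ioo_eq_nhdsLT ht₀]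
    exact nhdsWithin_mono _ Ioo_subset_Icc_self
  have hlog := ((Real.tendsto_log_nhdsGT_zero.comp hlim).const_mul_atBot
    (inv_pos.2 (two_pos : (0 : ℝ) < 2))).atBot_add (tendsto_const_nhds
      (x := -(2⁻¹ * Real.log (RCLike.re (evolvedGram Ξ n q ξ 0).det))))
  refine hlog.congr' (hmem.mono fun r hr => ?_)
  exact (sub_eq_add_neg _ _).symm.trans
    (integral_traceRate hN hA hξ hr.1.le (hpos r hr)).2.symm

end Main

end LiouvilleTrace

theorem mainTheorem3
    {𝕜 : Type*} [RCLike 𝕜]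
    {H : Type*} [NormedAddCommGroup H] [InnerProductSpace 𝕜 H] [CompleteSpace H]
    [TopologicalSpace.SeparableSpace H]
    {Q : Type*} [MetricSpace Q] [CompleteSpace Q]
    (θ : Flow ℝ≥0 Q) (Ξ : LiouvilleTrace.Cocycle 𝕜 H θ)
    (n : Q → InnerProductSpace.Core 𝕜 H) (N : Q → Submodule 𝕜 H)
    (hN : LiouvilleTrace.AdmitsGrowthExponents Ξ n N)
    (A : Q → H →ₗ.[𝕜] H) (hA : LiouvilleTrace.IsMeanRepresentation Ξ n N A)
    (m : ℕ) (hm : 1 ≤ m) (q : Q) (ξ : Fin m → H) (hξ : ∀ j, ξ j ∈ N q) :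
    -- the trace formula, as long as the volume has not vanished
    (∀ t : ℝ≥0, LiouvilleTrace.evolvedVolume Ξ n t q ξ ≠ 0 →
      IntervalIntegrable (fun s : ℝ => LiouvilleTrace.traceRate hN hA hξ s.toNNReal)
        MeasureTheory.volume 0 t ∧
      LiouvilleTrace.evolvedVolume Ξ n t q ξ =
        LiouvilleTrace.wedgeNorm (n q) m (exteriorPower.ιMulti 𝕜 m ξ) *
          Real.exp (∫ s in (0 : ℝ)..t, LiouvilleTrace.traceRate hN hA hξ s.toNNReal)) ∧
    -- a vanishing initial volume stays zero
    (LiouvilleTrace.wedgeNorm (n q) m (exteriorPower.ιMulti 𝕜 m ξ) = 0 →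
      ∀ t : ℝ≥0, LiouvilleTrace.evolvedVolume Ξ n t q ξ = 0) ∧
    -- if a nonzero initial volume evolves to zero, it is zero exactly from some first time on,
    -- at which the integral diverges to `-∞`
    (LiouvilleTrace.wedgeNorm (n q) m (exteriorPower.ιMulti 𝕜 m ξ) ≠ 0 →
      ∀ t : ℝ≥0, LiouvilleTrace.evolvedVolume Ξ n t q ξ = 0 →
        ∃ t₀ : ℝ≥0, 0 < t₀ ∧ t₀ ≤ t ∧
          (∀ s : ℝ≥0, LiouvilleTrace.evolvedVolume Ξ n s q ξ = 0 ↔ t₀ ≤ s) ∧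
          Filter.Tendsto
            (fun r : ℝ => ∫ s in (0 : ℝ)..r, LiouvilleTrace.traceRate hN hA hξ s.toNNReal)
            (𝓝[<] (t₀ : ℝ)) Filter.atBot) := by
  have hpos : ∀ t : ℝ≥0, LiouvilleTrace.evolvedVolume Ξ n t q ξ ≠ 0 →
      0 < RCLike.re (LiouvilleTrace.evolvedGram Ξ n q ξ t).det := fun t ht =>
    (LiouvilleTrace.re_det_evolvedGram_nonneg ξ t).lt_of_ne'
      (mt (LiouvilleTrace.evolvedVolume_eq_zero_iff ξ t).2 ht)
  -- The initial volume is treated as the evolved volume at time `0`.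
  rw [← LiouvilleTrace.evolvedVolume_zero (Ξ := Ξ)]
  refine ⟨fun t ht => ⟨?_, ?_⟩, fun h0 t => ?_, fun h0 t ht => ?_⟩
  · exact (LiouvilleTrace.integral_traceRate hN hA hξ t.coe_nonneg (hpos t ht)).1
  · exact LiouvilleTrace.evolvedVolume_eq_mul_exp hN hA hξ (hpos t ht)
  · by_contra ht
    refine (LiouvilleTrace.re_det_evolvedGram_pos_of_le t.coe_nonneg (hpos t ht)).ne' ?_
    exact (LiouvilleTrace.evolvedVolume_eq_zero_iff ξ 0).1 h0
  · obtain ⟨t₀, ht₀, hle, hzero⟩ := LiouvilleTrace.exists_first_zero hN hξ (hpos 0 h0)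
      t.coe_nonneg ((LiouvilleTrace.evolvedVolume_eq_zero_iff ξ t).1 ht)
    refine ⟨⟨t₀, ht₀.le⟩, ht₀, hle, fun s => ?_,
      LiouvilleTrace.tendsto_integral_traceRate_atBot hN hA hξ ht₀ hzero⟩
    rw [LiouvilleTrace.evolvedVolume_eq_zero_iff, hzero s s.coe_nonneg]
    rfl
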